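/- **Theorem.** Fix $k \ge 2$ and $n \ge 1$, and let $\rho = (1,k-1,1)$. *Prographs.* Let $\Delta_k$ be a formal $k$-ary coproduct ($1$ input, $k$ outputs) and $\mu_k$ a formal $k$-ary product ($k$ inputs, $1$ output). Let $\mathrm{PC}^k(n)$ be the set of closed $k$-ary product-coproduct prographs with $n$ products and $n$ coproducts: the upward directed plane graphs, up to isomorphism respecting the initial and the terminal vertex, the types of the nodes and the left-to-right orders of inputs and outputs, of the compositions with one input and one output that are built freely from $n$ copies of $\Delta_k$, $n$ copies of $\mu_k$ and identities by $\circ$ and $\otimes$. Let $r : \mathrm{PC}^k(n) \to \mathrm{PC}^k(n)$ be rotation by $180$ degrees together with reversal of the direction of all edges. *Tableaux.* Let $\mathbb{S}(n^3,\rho)$ be the set of standard set-valued Young tableaux of shape $n^3$ and density $\rho$: the placements of $1,\dots,N$, $N=(k+1)n$, in the cells of the $3\times n$ rectangle, with $\rho_i$ integers in every cell of row $i$, such that every integer in a cell is smaller than every integer in the cell to its right and in the cell below it. Let $f$ be the set-valued Schützenberger involution: rotate the tableau by $180$ degrees and replace every entry $a$ by $N+1-a$. *The map $\Phi$.* Label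 the $N+1$ edges of $G \in \mathrm{PC}^k(n)$ by the depth-left first search: the edge leaving the initial vertex gets the label $0$; when $0,\dots,i$ have been given, with $i<N$, let $V_i$ be the set of product and coproduct nodes all of whose inputs are labelled and at least one of whose outputs is not, take the highest labelled edge that ends at a node of $V_i$, and give the label $i+1$ to the leftmost unlabelled output of that node. Then $\Phi(G)$ is the filling of the $3 \times n$ rectangle with the labels of leftmost coproduct outputs in the top row, the labels of the other coproduct outputs in the middle row, and the labels of product outputs in the bottom row, placed in increasing order from left to right, $\rho_i$ of them in every cell of row $i$. Then $\Phi(G) \in \mathbb{S}(n^3,\rho)$ for every $G \in \mathrm{PC}^k(n)$, $f$ maps $\mathbb{S}(n^3,\rho)$ into itself, and $$\Phi \circ r = f \circ \Phi .$$ -/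

import Mathlib

/-- The sources from which the edges of a closed `k`-ary prograph with `n` coproduct nodes and `n`
product nodes may start: the initial vertex, the `j`-th output (from the left, counted from `0`) of
the coproduct node `c`, the only output of the product node `p`. -/
inductive PSource (k n : ℕ) where
  | initial : PSource k n
  | coOut (c : Fin n) (j : Fin k) : PSource k n
  | prOut (p : Fin n) : PSource k n

/-- The places where the edges may end: the terminal vertex, the only input of the coproduct
node `c`, the `j`-th input (from the left, counted from `0`) of the product node `p`. -/
inductive PTarget (k n : ℕ) where
  | terminal : PTarget k n
  | coIn (c : Fin n) : PTarget k n
  | prIn (p : Fin n) (j : Fin k) : PTarget k n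

/-- The operator nodes. -/
inductive PNode (n : ℕ) where
  | coproduct (c : Fin n) : PNode n
  | product (p : Fin n) : PNode n

/-- The edges, `(k + 1) * n + 1` in number. -/
abbrev PEdge (k n : ℕ) : Type := Fin ((k + 1) * n + 1)

/-- A directed graph with one initial vertex, one terminal vertex, `n` coproduct nodes (`1` input,
`k` outputs) and `n` product nodes (`k` inputs, `1` output), the inputs and the outputs of every
node being ordered from left to right: every edge has a source and a target, and every source and
every target is used by exactly one edge. Neither planarity nor acyclicity is required yet. -/
structure PGraph (k n : ℕ) where
  src : PEdge k n ≃ PSource k n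
  tgt : PEdge k n ≃ PTarget k n

namespace PGraph

variable {k n : ℕ}

/-- The edge that leaves the initial vertex. -/
def initialEdge (G : PGraph k n) : PEdge k n := G.src.symm PSource.initial

/-- The edge that enters the terminal vertex. -/
def terminalEdge (G : PGraph k n) : PEdge k n := G.tgt.symm PTarget.terminal

/-- The input edges of a node, from left to right. -/
def ins (G : PGraph k n) : PNode n → List (PEdge k n)
  | PNode.coproduct c => [G.tgt.symm (PTarget.coIn c)]
  | PNode.product p => List.ofFn fun j : Fin k => G.tgt.symm (PTarget.prIn p j)

/-- The output edges of a node, from left to right. -/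
def outs (G : PGraph k n) : PNode n → List (PEdge k n)
  | PNode.coproduct c => List.ofFn fun j : Fin k => G.src.symm (PSource.coOut c j)
  | PNode.product p => [G.src.symm (PSource.prOut p)]

/-- The operator node at which an edge ends (`none` for the terminal vertex). -/
def head (G : PGraph k n) (e : PEdge k n) : Option (PNode n) :=
  match G.tgt e with
  | PTarget.terminal => none
  | PTarget.coIn c => some (PNode.coproduct c)
  | PTarget.prIn p _ => some (PNode.product p)

/-- `G.Sweep s vs t`: starting from the horizontal cross-section `s` (the list of the edges that
are met, from left to right) and applying, from bottom to top, the operators at the nodes `vs` one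
at a time (each as `id ⊗ ⋯ ⊗ id ⊗ operator ⊗ id ⊗ ⋯ ⊗ id`, so that it consumes its inputs, which
stand next to one another and in order in the current cross-section, and puts its outputs in their
place), one arrives at the cross-section `t`. -/
inductive Sweep (G : PGraph k n) :
    List (PEdge k n) → List (PNode n) → List (PEdge k n) → Prop
  | nil (s : List (PEdge k n)) : Sweep G s [] s
  | cons (v : PNode n) (vs : List (PNode n)) (l r t : List (PEdge k n))
      (h : Sweep G (l ++ G.outs v ++ r) vs t) : Sweep G (l ++ G.ins v ++ r) (v :: vs) t

/-- `G` is the upward directed plane graph of a composition of operators with one input and one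
output: its nodes, each used once, can be swept from the initial edge to the terminal edge. -/
def IsComposition (G : PGraph k n) : Prop :=
  ∃ vs : List (PNode n), vs.Nodup ∧ (∀ v, v ∈ vs) ∧ G.Sweep [G.initialEdge] vs [G.terminalEdge]

end PGraph

/-- Renaming the nodes. -/
def PSource.rename {k n : ℕ} (σ τ : Equiv.Perm (Fin n)) : PSource k n → PSource k n
  | PSource.initial => PSource.initial
  | PSource.coOut c j => PSource.coOut (σ c) j
  | PSource.prOut p => PSource.prOut (τ p)

/-- Renaming the nodes. -/
def PTarget.rename {k n : ℕ} (σ τ : Equiv.Perm (Fin n)) : PTarget k n → PTarget k n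
  | PTarget.terminal => PTarget.terminal
  | PTarget.coIn c => PTarget.coIn (σ c)
  | PTarget.prIn p j => PTarget.prIn (τ p) j

/-- Renaming the nodes. -/
def PNode.rename {n : ℕ} (σ τ : Equiv.Perm (Fin n)) : PNode n → PNode n
  | PNode.coproduct c => PNode.coproduct (σ c)
  | PNode.product p => PNode.product (τ p)

/-- Two graphs are isomorphic if they differ in the names of nodes and edges only. -/
def PGraph.Iso {k n : ℕ} (G H : PGraph k n) : Prop :=
  ∃ (σ τ : Equiv.Perm (Fin n)) (ε : Equiv.Perm (PEdge k n)), ∀ e,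
    H.src (ε e) = (G.src e).rename σ τ ∧ H.tgt (ε e) = (G.tgt e).rename σ τ

/-- A closed `k`-ary product-coproduct prograph with `n` products and `n` coproducts, with names
for its nodes and edges. -/
def NamedPrograph (k n : ℕ) : Type := {G : PGraph k n // G.IsComposition}

theorem PGraph.Iso.refl {k n : ℕ} (G : PGraph k n) : G.Iso G := by
  refine ⟨1, 1, 1, fun e => ⟨?_, ?_⟩⟩
  · rw [Equiv.Perm.one_apply]; cases G.src e <;> rfl
  · rw [Equiv.Perm.one_apply]; cases G.tgt e <;> rfl

theorem PGraph.Iso.symm {k n : ℕ} {G H : PGraph k n} (h : G.Iso H) : H.Iso G := by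
  obtain ⟨σ, τ, ε, h⟩ := h
  refine ⟨σ.symm, τ.symm, ε.symm, fun e => ⟨?_, ?_⟩⟩
  · have := (h (ε.symm e)).1
    rw [Equiv.apply_symm_apply] at this
    rw [this]
    cases G.src (ε.symm e) <;> simp [PSource.rename]
  · have := (h (ε.symm e)).2
    rw [Equiv.apply_symm_apply] at this
    rw [this]
    cases G.tgt (ε.symm e) <;> simp [PTarget.rename]

theorem PGraph.Iso.trans {k n : ℕ} {G H K : PGraph k n} (h : G.Iso H) (h' : H.Iso K) :
    G.Iso K := by
  obtain ⟨σ, τ, ε, h⟩ := h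
  obtain ⟨σ', τ', ε', h'⟩ := h'
  refine ⟨σ' * σ, τ' * τ, ε' * ε, fun e => ⟨?_, ?_⟩⟩
  · rw [Equiv.Perm.mul_apply, (h' (ε e)).1, (h e).1]
    cases G.src e <;> rfl
  · rw [Equiv.Perm.mul_apply, (h' (ε e)).2, (h e).2]
    cases G.tgt e <;> rfl

instance prographSetoid (k n : ℕ) : Setoid (NamedPrograph k n) where
  r G H := G.1.Iso H.1
  iseqv := ⟨fun G => PGraph.Iso.refl G.1, fun h => PGraph.Iso.symm h,
    fun h h' => PGraph.Iso.trans h h'⟩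

/-- The set `PC^k(n)` of closed `k`-ary product-coproduct prographs with `n` products and `n`
coproducts. -/
def PC (k n : ℕ) : Type := Quotient (prographSetoid k n)

/-! ### Rotation -/

/-- The effect on targets of a rotation by 180 degrees with reversal of all edges: a coproduct
becomes a product and conversely, and left and right are exchanged. -/
def PTarget.rotate (k n : ℕ) : PTarget k n ≃ PSource k n where
  toFun
    | PTarget.terminal => PSource.initial
    | PTarget.coIn c => PSource.prOut c
    | PTarget.prIn p j => PSource.coOut p j.rev
  invFun
    | PSource.initial => PTarget.terminal
    | PSource.coOut c j => PTarget.prIn c j.rev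
    | PSource.prOut p => PTarget.coIn p
  left_inv x := by cases x <;> simp
  right_inv x := by cases x <;> simp

/-- The node that a node becomes under rotation. -/
def PNode.rotate {n : ℕ} : PNode n → PNode n
  | PNode.coproduct c => PNode.product c
  | PNode.product p => PNode.coproduct p

/-- Rotation of a graph by 180 degrees, with reversal of the direction of all edges. -/
def PGraph.rotate {k n : ℕ} (G : PGraph k n) : PGraph k n where
  src := G.tgt.trans (PTarget.rotate k n)
  tgt := G.src.trans (PTarget.rotate k n).symm

theorem reverse_ofFn_rev {α : Type} {k : ℕ} (f : Fin k → α) :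
    (List.ofFn f).reverse = List.ofFn fun j => f j.rev := by
  refine List.ext_getElem (by simp) fun i h₁ h₂ => ?_
  simp only [List.getElem_ofFn, List.getElem_reverse, List.length_ofFn]
  exact congrArg f (Fin.ext (by simp [Fin.rev]; omega))

theorem PGraph.ins_rotate {k n : ℕ} (G : PGraph k n) (v : PNode n) :
    G.rotate.ins v.rotate = (G.outs v).reverse := by
  cases v with
  | coproduct c =>
    exact (reverse_ofFn_rev fun j => G.src.symm (PSource.coOut c j)).symm
  | product p => rfl

theorem PGraph.outs_rotate {k n : ℕ} (G : PGraph k n) (v : PNode n) :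
    G.rotate.outs v.rotate = (G.ins v).reverse := by
  cases v with
  | coproduct c => rfl
  | product p =>
    exact (reverse_ofFn_rev fun j => G.tgt.symm (PTarget.prIn p j)).symm

theorem PGraph.Sweep.append {k n : ℕ} {G : PGraph k n} {s t u : List (PEdge k n)}
    {vs ws : List (PNode n)} (h : G.Sweep s vs t) (h' : G.Sweep t ws u) :
    G.Sweep s (vs ++ ws) u := by
  induction h with
  | nil s => exact h'
  | cons v vs l r t _ ih => exact Sweep.cons v (vs ++ ws) l r u (ih h')

theorem PGraph.Sweep.rotate {k n : ℕ} {G : PGraph k n} {s t : List (PEdge k n)}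
    {vs : List (PNode n)} (h : G.Sweep s vs t) :
    G.rotate.Sweep t.reverse (vs.map PNode.rotate).reverse s.reverse := by
  induction h with
  | nil s => exact Sweep.nil _
  | cons v vs l r t _ ih =>
    rw [List.map_cons, List.reverse_cons]
    refine ih.append ?_
    have := Sweep.cons (G := G.rotate) v.rotate [] r.reverse l.reverse _ (Sweep.nil _)
    rw [PGraph.ins_rotate, PGraph.outs_rotate] at this
    simpa [List.reverse_append] using this

theorem PNode.rotate_rotate {n : ℕ} (v : PNode n) : v.rotate.rotate = v := by
  cases v <;> rfl

theorem PGraph.IsComposition.rotate {k n : ℕ} {G : PGraph k n} (h : G.IsComposition) :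
    G.rotate.IsComposition := by
  obtain ⟨vs, hnd, hall, hs⟩ := h
  refine ⟨(vs.map PNode.rotate).reverse, ?_, fun v => ?_, hs.rotate⟩
  · rw [List.nodup_reverse]
    exact hnd.map (Function.LeftInverse.injective PNode.rotate_rotate)
  · rw [List.mem_reverse, List.mem_map]
    exact ⟨v.rotate, hall _, v.rotate_rotate⟩

theorem PGraph.Iso.rotate {k n : ℕ} {G H : PGraph k n} (h : G.Iso H) :
    G.rotate.Iso H.rotate := by
  obtain ⟨σ, τ, ε, h⟩ := h
  refine ⟨τ, σ, ε, fun e => ⟨?_, ?_⟩⟩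
  · simp only [PGraph.rotate, Equiv.trans_apply, (h e).2]
    cases G.tgt e <;> rfl
  · simp only [PGraph.rotate, Equiv.trans_apply, (h e).1]
    cases G.src e <;> rfl

/-- The rotation operator `r` on `PC^k(n)`. -/
def PC.rotate {k n : ℕ} : PC k n → PC k n :=
  Quotient.map (fun G : NamedPrograph k n => (⟨G.1.rotate, G.2.rotate⟩ : NamedPrograph k n))
    fun _ _ h => PGraph.Iso.rotate h

/-! ### The depth-left first search -/

namespace PGraph

variable {k n : ℕ}

/-- One step of the depth-left first search. The list `L` holds the edges labelled so far, the
highest label first. A node is available if all its inputs are labelled and at least one of its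
outputs is not. Take the highest labelled edge that ends at an available node `v`; the edge to be
labelled next is the leftmost unlabelled output of `v`. -/
def nextEdge (G : PGraph k n) (L : List (PEdge k n)) : Option (PEdge k n) :=
  L.findSome? fun e => (G.head e).bind fun v =>
    if ∀ a ∈ G.ins v, a ∈ L then (G.outs v).find? fun b => decide (b ∉ L) else none

/-- The list of the edges labelled `i, i - 1, …, 0`, in this order. -/
def searchList (G : PGraph k n) : ℕ → List (PEdge k n)
  | 0 => [G.initialEdge]
  | i + 1 => (G.nextEdge (G.searchList i)).toList ++ G.searchList i

/-- The label that the depth-left first search gives to an edge, from `0` to `(k + 1) * n`. -/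
def edgeLabel (G : PGraph k n) (e : PEdge k n) : ℕ :=
  (G.searchList ((k + 1) * n)).reverse.idxOf e

/-- The row of the tableau that receives the label of an edge: the top row (`0`) for leftmost
coproduct children, the middle row (`1`) for all other coproduct children, the bottom row (`2`) for
product children; the initial edge is ignored. -/
def edgeRow (G : PGraph k n) (e : PEdge k n) : Option (Fin 3) :=
  match G.src e with
  | PSource.initial => none
  | PSource.coOut _ j => if j.val = 0 then some 0 else some 1
  | PSource.prOut _ => some 2

/-- The integers that go to a given row of the tableau. -/
def rowLabels (G : PGraph k n) (i : Fin 3) : Finset ℕ :=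
  (Finset.univ.filter fun e => G.edgeRow e = some i).image G.edgeLabel

end PGraph

/-! ### Set-valued tableaux -/

/-- A filling of the `m × n` rectangular Young diagram with sets of integers; `T i j` is the set in
the cell of row `i` (from the top) and column `j` (from the left). -/
abbrev SetFilling (m n : ℕ) : Type := Fin m → Fin n → Finset ℕ

/-- `T` is a standard set-valued Young tableau of rectangular shape `n^m` and row-constant
density `ρ`. -/
structure SetFilling.IsStandard {m n : ℕ} (ρ : Fin m → ℕ) (T : SetFilling m n) : Prop where
  mem_range : ∀ i j, ∀ a ∈ T i j, 1 ≤ a ∧ a ≤ n * ∑ i, ρ i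
  existsUnique_cell : ∀ a, 1 ≤ a → a ≤ n * ∑ i, ρ i → ∃! c : Fin m × Fin n, a ∈ T c.1 c.2
  card_cell : ∀ i j, (T i j).card = ρ i
  row_lt : ∀ (i : Fin m) (j j' : Fin n), j.val + 1 = j'.val → ∀ a ∈ T i j, ∀ b ∈ T i j', a < b
  col_lt : ∀ (i i' : Fin m) (j : Fin n), i.val + 1 = i'.val → ∀ a ∈ T i j, ∀ b ∈ T i' j, a < b

/-- The set `𝕊(n^m, ρ)` of standard set-valued Young tableaux. -/
def SVT {m : ℕ} (n : ℕ) (ρ : Fin m → ℕ) : Set (SetFilling m n) := {T | T.IsStandard ρ}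

/-- The set-valued Schützenberger involution: rotate by 180 degrees and reverse the order of the
entries `1, …, M`, where `M = n * ∑ i, ρ i`. -/
def schutzenberger {m n : ℕ} (ρ : Fin m → ℕ) (T : SetFilling m n) : SetFilling m n :=
  fun i j => (T i.rev j.rev).image fun a => n * ∑ i, ρ i + 1 - a

/-- The density `(1, k - 1, 1)`. -/
def rowDensity (k : ℕ) : Fin 3 → ℕ := ![1, k - 1, 1]

/-- The part of `R` that goes to the cell of column `j` if the integers in `R` are placed in
increasing order from left to right, `d` of them in each cell. -/
def blockOf (R : Finset ℕ) (d j : ℕ) : Finset ℕ :=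
  R.filter fun a => (R.filter fun b => b < a).card / d = j

/-- The tableau of a graph. -/
def PGraph.tableau {k n : ℕ} (G : PGraph k n) : SetFilling 3 n :=
  fun i j => blockOf (G.rowLabels i) (rowDensity k i) j.val

/-! ### The tableau of a graph does not depend on the names of nodes and edges -/

namespace PGraph

variable {k n : ℕ}

theorem tableau_eq_of_iso {G H : PGraph k n} (h : G.Iso H) : G.tableau = H.tableau := by
  obtain ⟨σ, τ, ε, h⟩ := h
  have hsrc : ∀ x, H.src.symm (PSource.rename σ τ x) = ε (G.src.symm x) := fun x => by
    rw [Equiv.symm_apply_eq, (h _).1, Equiv.apply_symm_apply]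
  have htgt : ∀ x, H.tgt.symm (PTarget.rename σ τ x) = ε (G.tgt.symm x) := fun x => by
    rw [Equiv.symm_apply_eq, (h _).2, Equiv.apply_symm_apply]
  have hins : ∀ v, H.ins (PNode.rename σ τ v) = (G.ins v).map ε := by
    rintro (c | p)
    · exact congrArg (fun x => [x]) (htgt (PTarget.coIn c))
    · simp only [PNode.rename, ins, List.map_ofFn]
      exact congrArg List.ofFn (funext fun j => htgt (PTarget.prIn p j))
  have houts : ∀ v, H.outs (PNode.rename σ τ v) = (G.outs v).map ε := by
    rintro (c | p)
    · simp only [PNode.rename, outs, List.map_ofFn]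
      exact congrArg List.ofFn (funext fun j => hsrc (PSource.coOut c j))
    · exact congrArg (fun x => [x]) (hsrc (PSource.prOut p))
  have hhead : ∀ e, H.head (ε e) = (G.head e).map (PNode.rename σ τ) := fun e => by
    simp only [head, (h e).2]
    cases G.tgt e <;> rfl
  have hmem : ∀ (L : List (PEdge k n)) a, ε a ∈ L.map ε ↔ a ∈ L := fun L a =>
    List.mem_map_of_injective ε.injective
  have hnext : ∀ L, H.nextEdge (L.map ε) = (G.nextEdge L).map ε := fun L => by
    simp only [nextEdge]
    rw [List.findSome?_map, List.map_findSome?]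
    congr 1
    funext e
    simp only [Function.comp_apply, hhead]
    cases G.head e with
    | none => rfl
    | some v =>
      simp only [Option.map_some, Option.bind_some, hins, houts, List.forall_mem_map, hmem]
      split_ifs
      · rw [List.find?_map]
        congr 2
        funext b
        simp only [Function.comp_apply, hmem]
      · rfl
  have hsearch : ∀ i, H.searchList i = (G.searchList i).map ε := fun i => by
    induction i with
    | zero => exact congrArg (fun x => [x]) (hsrc PSource.initial)
    | succ i ih =>
      simp only [searchList, ih, hnext, List.map_append]
      cases G.nextEdge (G.searchList i) <;> rfl
  have hidx : ∀ (L : List (PEdge k n)) e, (L.map ε).idxOf (ε e) = L.idxOf e := fun L e => by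
    induction L with
    | nil => rfl
    | cons a L ih =>
      rw [List.map_cons, List.idxOf_cons, List.idxOf_cons, ih]
      by_cases hae : a = e
      · simp [hae]
      · rw [beq_false_of_ne hae, beq_false_of_ne (ε.injective.ne hae)]
  have hlabel : ∀ e, H.edgeLabel (ε e) = G.edgeLabel e := fun e => by
    simp only [edgeLabel, hsearch]
    rw [← List.map_reverse, hidx]
  have hrow : ∀ e, H.edgeRow (ε e) = G.edgeRow e := fun e => by
    simp only [edgeRow, (h e).1]
    cases G.src e <;> rfl
  have hrows : ∀ i, G.rowLabels i = H.rowLabels i := fun i => by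
    ext a
    simp only [rowLabels, Finset.mem_image, Finset.mem_filter, Finset.mem_univ, true_and]
    constructor
    · rintro ⟨e, he, rfl⟩
      exact ⟨ε e, (hrow e).trans he, hlabel e⟩
    · rintro ⟨e, he, rfl⟩
      obtain ⟨e, rfl⟩ := ε.surjective e
      exact ⟨e, (hrow e).symm.trans he, (hlabel e).symm⟩
  funext i j
  simp only [tableau, hrows]

end PGraph

/-- The map `Φ` from `PC^k(n)` to tableaux with three rows and `n` columns. -/
def PC.tableau {k n : ℕ} : PC k n → SetFilling 3 n :=
  Quotient.lift (fun G : NamedPrograph k n => G.1.tableau) fun _ _ h => PGraph.tableau_eq_of_iso h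

/-! Write `N = (k + 1) * n`. The theorem holds because the search labels are characterised by
conditions that survive rotation. Call a numbering of the edges by `0, …, N` depth-left if the
initial and terminal edges have the numbers `0` and `N`, inputs and outputs of each node increase
from left to right, the last input of `v` has some number `cut v` and its first output the number
`cut v + 1`, and different nodes are nested: an output of `v` numbered above `cut w > cut v` comes
after all outputs of `w`, and dually for inputs.

Such a numbering exists: sweep the graph and insert the outputs of each node directly after its last
input (`PartialOrderOn.step`). The search must follow any such numbering (`nextEdge_eq`,
`edgeLabel_eq`). Replacing `i` by `N - i` while turning the graph round exchanges the conditions on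
inputs with those on outputs (`IsDepthLeftOrder.rotate`), so the labels of the rotated graph are `N`
minus the old ones.

The top and bottom rows consist of the numbers `cut v + 1` for coproducts and products respectively.
Rotation makes the last input of `v` a first output, with label `N - cut v = N + 1 - (cut v + 1)`;
hence `a ↦ N + 1 - a` exchanges these two rows. The middle row is the complement in `1, …, N` and is
therefore reflected too, with no need to match single edges (`rowLabels_rotate`). For standardness,
top against middle is a count (`rankIn_one_lt`), and middle against bottom is the same statement for
the rotated graph. -/

namespace PGraph

/-! ### Incidence of edges and nodes -/

variable {k n : ℕ}

/-- The operator node at which an edge starts (`none` for the initial vertex). -/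
def tail (G : PGraph k n) (e : PEdge k n) : Option (PNode n) :=
  match G.src e with
  | PSource.initial => none
  | PSource.coOut c _ => some (PNode.coproduct c)
  | PSource.prOut p => some (PNode.product p)

theorem mem_outs {G : PGraph k n} {v : PNode n} {e : PEdge k n} :
    e ∈ G.outs v ↔ G.tail e = some v := by
  obtain ⟨x, rfl⟩ := G.src.symm.surjective e
  cases v <;> cases x <;> simp [outs, tail, List.mem_ofFn, eq_comm]

theorem mem_ins {G : PGraph k n} {v : PNode n} {e : PEdge k n} :
    e ∈ G.ins v ↔ G.head e = some v := by
  obtain ⟨x, rfl⟩ := G.tgt.symm.surjective e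
  cases v <;> cases x <;> simp [ins, head, List.mem_ofFn, eq_comm]

theorem nodup_outs (G : PGraph k n) (v : PNode n) : (G.outs v).Nodup := by
  cases v
  · refine List.nodup_ofFn.2 fun i j h => ?_
    simpa using h
  · simp [outs]

theorem outs_ne_nil (hk : 0 < k) (G : PGraph k n) (v : PNode n) : G.outs v ≠ [] := by
  cases v <;> simp [outs]; omega

theorem ins_ne_nil (hk : 0 < k) (G : PGraph k n) (v : PNode n) : G.ins v ≠ [] := by
  cases v <;> simp [ins]; omega

theorem tail_initialEdge (G : PGraph k n) : G.tail G.initialEdge = none := by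
  simp [tail, initialEdge]

theorem eq_initialEdge_of_tail {G : PGraph k n} {e : PEdge k n} (h : G.tail e = none) :
    e = G.initialEdge := by
  obtain ⟨x, rfl⟩ := G.src.symm.surjective e
  cases x <;> simp_all [tail, initialEdge]

/-! ### Building a depth-left numbering along a sweep -/

/-- A numbering `pos` of the edges in a set `S`, compatible with the nodes in a set `U`: the last
input of the node `v` has the number `cut v` and its first output the number `cut v + 1`, and the
inputs and the outputs of different nodes are nested. The list `s` is a cross-section above the
nodes in `U`. -/
structure PartialOrderOn (G : PGraph k n) (U : Set (PNode n)) (S : Finset (PEdge k n))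
    (s : List (PEdge k n)) (pos : PEdge k n → ℕ) (cut : PNode n → ℕ) : Prop where
  injOn : Set.InjOn pos S
  pos_lt : ∀ x ∈ S, pos x < S.card
  sorted : s.Pairwise (pos · < pos ·)
  subset : ∀ x ∈ s, x ∈ S
  notMem_ins : ∀ x ∈ s, ∀ v ∈ U, x ∉ G.ins v
  -- At the end of the sweep the cross-section is the terminal edge alone, which therefore gets the
  -- last number.
  exists_last : ∃ x ∈ s, pos x + 1 = S.card
  initial_mem : G.initialEdge ∈ S
  pos_initial : pos G.initialEdge = 0
  exists_tail : ∀ x ∈ S, x = G.initialEdge ∨ ∃ v ∈ U, x ∈ G.outs v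
  ins_subset : ∀ v ∈ U, ∀ x ∈ G.ins v, x ∈ S
  outs_subset : ∀ v ∈ U, ∀ x ∈ G.outs v, x ∈ S
  ins_le : ∀ v ∈ U, ∀ x ∈ G.ins v, pos x ≤ cut v
  lt_outs : ∀ v ∈ U, ∀ x ∈ G.outs v, cut v < pos x
  exists_in : ∀ v ∈ U, ∃ x ∈ G.ins v, pos x = cut v
  exists_out : ∀ v ∈ U, ∃ x ∈ G.outs v, pos x = cut v + 1
  ins_sorted : ∀ v ∈ U, (G.ins v).Pairwise (pos · < pos ·)
  outs_sorted : ∀ v ∈ U, (G.outs v).Pairwise (pos · < pos ·)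
  outs_nested : ∀ v ∈ U, ∀ w ∈ U, ∀ x ∈ G.outs v, cut v < cut w → cut w < pos x →
    ∀ y ∈ G.outs w, pos y < pos x
  ins_nested : ∀ v ∈ U, ∀ w ∈ U, ∀ x ∈ G.ins v, cut w < cut v → pos x ≤ cut w →
    ∀ y ∈ G.ins w, pos x < pos y
  -- Needed only during the induction, to preserve `ins_nested`: an edge still waiting in the
  -- cross-section is never numbered between two inputs of a node already passed.
  gap : ∀ v ∈ U, ∀ x ∈ s, ∀ y ∈ G.ins v, pos y < pos x → cut v < pos x

-- The outputs of `v` are inserted directly after its last input `a`, and all later numbers move up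
-- by the number of outputs. Old comparisons are unchanged, so only those involving `v` need an
-- argument.
open Classical in
theorem PartialOrderOn.step (hk : 0 < k) {G : PGraph k n} {U : Set (PNode n)}
    {S : Finset (PEdge k n)} {l r : List (PEdge k n)} {v : PNode n}
    {pos : PEdge k n → ℕ} {cut : PNode n → ℕ}
    (h : G.PartialOrderOn U S (l ++ G.ins v ++ r) pos cut) (hv : v ∉ U) :
    ∃ S' pos' cut', G.PartialOrderOn (insert v U) S' (l ++ G.outs v ++ r) pos' cut' := by
  obtain ⟨i, a, hia⟩ : ∃ i a, G.ins v = i ++ [a] := by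
    rcases List.eq_nil_or_concat (G.ins v) with h0 | ⟨i, a, h0⟩
    · exact absurd h0 (ins_ne_nil hk G v)
    · exact ⟨i, a, by simpa using h0⟩
  have ha : a ∈ G.ins v := by simp [hia]
  have has : a ∈ l ++ G.ins v ++ r := by simp [ha]
  have haS : a ∈ S := h.subset a has
  have hsort := h.sorted
  have hinsSort : (G.ins v).Pairwise (pos · < pos ·) := by
    rw [List.append_assoc, List.pairwise_append, List.pairwise_append] at hsort
    exact hsort.2.1.1
  have hins_le : ∀ x ∈ G.ins v, pos x ≤ pos a := by
    intro x hx
    rw [hia] at hx hinsSort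
    rcases List.mem_append.1 hx with hx | hx
    · exact ((List.pairwise_append.1 hinsSort).2.2 x hx a (by simp)).le
    · rw [List.mem_singleton.1 hx]
  have hl_lt : ∀ x ∈ l, ∀ y ∈ G.ins v, pos x < pos y := by
    rw [List.append_assoc, List.pairwise_append] at hsort
    exact fun x hx y hy => hsort.2.2 x hx y (by simp [hy])
  have hr_lt : ∀ x ∈ r, pos a < pos x := by
    rw [List.pairwise_append] at hsort
    exact fun x hx => hsort.2.2 a (by simp [ha]) x hx
  have hlr : ∀ x ∈ l, ∀ y ∈ r, pos x < pos y := by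
    rw [List.pairwise_append] at hsort
    exact fun x hx y hy => hsort.2.2 x (by simp [hx]) y hy
  have hfresh : ∀ x ∈ G.outs v, x ∉ S := by
    intro x hx hxS
    rcases h.exists_tail x hxS with rfl | ⟨w, hw, hxw⟩
    · rw [mem_outs, tail_initialEdge] at hx
      cases hx
    · rw [mem_outs] at hx hxw
      rw [hx] at hxw
      cases hxw
      exact hv hw
  have hm : 0 < (G.outs v).length := List.length_pos_iff.2 (outs_ne_nil hk G v)
  set m := (G.outs v).length with hmdef
  set S' := S ∪ (G.outs v).toFinset with hS'
  have hcard : S'.card = S.card + m := by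
    rw [hS', Finset.card_union_of_disjoint, List.toFinset_card_of_nodup (nodup_outs G v)]
    rw [Finset.disjoint_right]
    exact fun x hx => hfresh x (List.mem_toFinset.1 hx)
  have hmemS' : ∀ x, x ∈ S' ↔ x ∈ S ∨ x ∈ G.outs v := fun x => by simp [hS']
  -- The `m` new edges occupy the places `pos a + 1, …, pos a + m`.
  let pos' : PEdge k n → ℕ := fun x =>
    if x ∈ S then (if pos x ≤ pos a then pos x else pos x + m)
    else pos a + 1 + (G.outs v).idxOf x
  let cut' : PNode n → ℕ := fun w =>
    if w = v then pos a else if cut w ≤ pos a then cut w else cut w + m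
  have hold : ∀ x ∈ S, (pos x ≤ pos a ∧ pos' x = pos x) ∨ (pos a < pos x ∧ pos' x = pos x + m) := by
    intro x hx
    by_cases h1 : pos x ≤ pos a
    · left; simp [pos', hx, h1]
    · right; exact ⟨by omega, by simp [pos', hx, h1]⟩
  have hnew : ∀ x ∈ G.outs v,
      pos' x = pos a + 1 + (G.outs v).idxOf x ∧ (G.outs v).idxOf x < m := by
    intro x hx
    exact ⟨by simp [pos', hfresh x hx], List.idxOf_lt_length_of_mem hx⟩
  have hget : ∀ j (hj : j < m), ∃ x ∈ G.outs v, pos' x = pos a + 1 + j := by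
    intro j hj
    refine ⟨(G.outs v)[j], List.getElem_mem _, ?_⟩
    rw [(hnew _ (List.getElem_mem _)).1, (nodup_outs G v).idxOf_getElem]
  have hcutv : cut' v = pos a := by simp [cut']
  -- Equality `cut w = pos a` cannot occur: `cut w` is the number of an input of `w`, whereas `a` is
  -- not yet consumed by a node of `U`.
  have hcut : ∀ w ∈ U, (cut w < pos a ∧ cut' w = cut w) ∨
      (pos a < cut w ∧ cut' w = cut w + m) := by
    intro w hw
    obtain ⟨z, hz, hzc⟩ := h.exists_in w hw
    have hwv : w ≠ v := fun e => hv (e ▸ hw)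
    have hza : pos a ≠ cut w := by
      rw [← hzc]
      intro e
      have := h.injOn haS (h.ins_subset w hw z hz) e
      exact h.notMem_ins a has w hw (this ▸ hz)
    by_cases h1 : cut w ≤ pos a
    · left; exact ⟨by omega, by simp [cut', hwv, h1]⟩
    · right; exact ⟨by omega, by simp [cut', hwv, h1]⟩
  have hmono : ∀ x ∈ S, ∀ y ∈ S, pos x < pos y → pos' x < pos' y := by
    intro x hx y hy hxy
    have := hold x hx
    have := hold y hy
    omega
  have hlS : ∀ x ∈ l, x ∈ S := fun x hx => h.subset x (by simp [hx])
  have hrS : ∀ x ∈ r, x ∈ S := fun x hx => h.subset x (by simp [hx])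
  have hinS : ∀ x ∈ G.ins v, x ∈ S := fun x hx => h.subset x (by simp [hx])
  have houtsSort : (G.outs v).Pairwise (pos' · < pos' ·) := by
    rw [List.pairwise_iff_getElem]
    intro i j hi hj hij
    rw [(hnew _ (List.getElem_mem _)).1, (hnew _ (List.getElem_mem _)).1,
      (nodup_outs G v).idxOf_getElem, (nodup_outs G v).idxOf_getElem]
    omega
  have hpos_of_mono : ∀ L : List (PEdge k n), (∀ x ∈ L, x ∈ S) → L.Pairwise (pos · < pos ·) →
      L.Pairwise (pos' · < pos' ·) := fun L hL hs =>
    hs.imp_of_mem fun hx hy hxy => hmono _ (hL _ hx) _ (hL _ hy) hxy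
  refine ⟨S', pos', cut', ?_⟩
  constructor
  case injOn =>
    intro x hx y hy hxy
    rw [Finset.mem_coe, hmemS'] at hx hy
    rcases hx with hx | hx <;> rcases hy with hy | hy
    · have := hold x hx
      have := hold y hy
      exact h.injOn hx hy (by omega)
    · have := hold x hx
      have := hnew y hy
      omega
    · have := hnew x hx
      have := hold y hy
      omega
    · have := hnew x hx
      have := hnew y hy
      exact (List.idxOf_inj hx).1 (by omega)
  case pos_lt =>
    intro x hx
    rw [hcard]
    rcases (hmemS' x).1 hx with hx | hx
    · have := hold x hx
      have := h.pos_lt x hx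
      omega
    · have := hnew x hx
      have := h.pos_lt a haS
      omega
  case sorted =>
    have h1 : l.Pairwise (pos · < pos ·) := by
      rw [List.append_assoc, List.pairwise_append] at hsort
      exact hsort.1
    have h2 : r.Pairwise (pos · < pos ·) := by
      rw [List.pairwise_append] at hsort
      exact hsort.2.1
    rw [List.pairwise_append, List.pairwise_append]
    refine ⟨⟨hpos_of_mono l hlS h1, houtsSort, ?_⟩, hpos_of_mono r hrS h2, ?_⟩
    · intro x hx y hy
      have := hold x (hlS x hx)
      have := hnew y hy
      have := hl_lt x hx a ha
      omega
    · intro x hx y hy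
      have h3 := hold y (hrS y hy)
      have h4 := hr_lt y hy
      rcases List.mem_append.1 hx with hx | hx
      · exact hmono x (hlS x hx) y (hrS y hy) (hlr x hx y hy)
      · have := hnew x hx
        omega
  case subset =>
    intro x hx
    rw [hmemS']
    simp only [List.mem_append] at hx
    rcases hx with (hx | hx) | hx
    · exact Or.inl (hlS x hx)
    · exact Or.inr hx
    · exact Or.inl (hrS x hx)
  case notMem_ins =>
    intro x hx w hw hxw
    simp only [List.mem_append] at hx
    rcases hx with (hx | hx) | hx
    · rcases hw with rfl | hw
      · exact lt_irrefl _ (hl_lt x hx x hxw)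
      · exact h.notMem_ins x (by simp [hx]) w hw hxw
    · rcases hw with rfl | hw
      · exact hfresh x hx (hinS x hxw)
      · exact hfresh x hx (h.ins_subset w hw x hxw)
    · rcases hw with rfl | hw
      · exact absurd (hr_lt x hx) (hins_le x hxw).not_gt
      · exact h.notMem_ins x (by simp [hx]) w hw hxw
  case exists_last =>
    obtain ⟨x, hx, hxc⟩ := h.exists_last
    rw [hcard]
    -- If the last edge is not to the right of the inputs of `v`, then `a` was last, and now the
    -- last output of `v` is.
    by_cases hxr : x ∈ r
    · refine ⟨x, by simp [hxr], ?_⟩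
      have := hold x (hrS x hxr)
      have := hr_lt x hxr
      omega
    · have : pos x ≤ pos a := by
        simp only [List.mem_append, hxr, or_false] at hx
        rcases hx with hx | hx
        · exact (hl_lt x hx a ha).le
        · exact hins_le x hx
      have := h.pos_lt a haS
      obtain ⟨y, hy, hyp⟩ := hget (m - 1) (by omega)
      exact ⟨y, by simp [hy], by omega⟩
  case initial_mem => exact (hmemS' _).2 (Or.inl h.initial_mem)
  case pos_initial =>
    have := hold _ h.initial_mem
    have := h.pos_initial
    omega
  case exists_tail =>
    intro x hx
    rcases (hmemS' x).1 hx with hx | hx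
    · rcases h.exists_tail x hx with hx | ⟨w, hw, hx⟩
      · exact Or.inl hx
      · exact Or.inr ⟨w, Or.inr hw, hx⟩
    · exact Or.inr ⟨v, Or.inl rfl, hx⟩
  case ins_subset =>
    rintro w (rfl | hw) x hx
    · exact (hmemS' x).2 (Or.inl (hinS x hx))
    · exact (hmemS' x).2 (Or.inl (h.ins_subset w hw x hx))
  case outs_subset =>
    rintro w (rfl | hw) x hx
    · exact (hmemS' x).2 (Or.inr hx)
    · exact (hmemS' x).2 (Or.inl (h.outs_subset w hw x hx))
  case ins_le =>
    rintro w (rfl | hw) x hx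
    · have := hold x (hinS x hx)
      have := hins_le x hx
      omega
    · have := hold x (h.ins_subset w hw x hx)
      have := hcut w hw
      have := h.ins_le w hw x hx
      omega
  case lt_outs =>
    rintro w (rfl | hw) x hx
    · have := hnew x hx
      omega
    · have := hold x (h.outs_subset w hw x hx)
      have := hcut w hw
      have := h.lt_outs w hw x hx
      omega
  case exists_in =>
    rintro w (rfl | hw)
    · refine ⟨a, ha, ?_⟩
      have := hold a haS
      omega
    · obtain ⟨x, hx, hxc⟩ := h.exists_in w hw
      refine ⟨x, hx, ?_⟩
      have := hold x (h.ins_subset w hw x hx)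
      have := hcut w hw
      omega
  case exists_out =>
    rintro w (rfl | hw)
    · obtain ⟨y, hy, hyp⟩ := hget 0 hm
      exact ⟨y, hy, by omega⟩
    · obtain ⟨x, hx, hxc⟩ := h.exists_out w hw
      refine ⟨x, hx, ?_⟩
      have := hold x (h.outs_subset w hw x hx)
      have := hcut w hw
      omega
  case ins_sorted =>
    rintro w (rfl | hw)
    · exact hpos_of_mono _ hinS hinsSort
    · exact hpos_of_mono _ (h.ins_subset w hw) (h.ins_sorted w hw)
  case outs_sorted =>
    rintro w (rfl | hw)
    · exact houtsSort
    · exact hpos_of_mono _ (h.outs_subset w hw) (h.outs_sorted w hw)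
  -- The new outputs form an interval directly after `pos a`: no old cut falls among them, and an
  -- old edge after `a` comes after all of them.
  case outs_nested =>
    rintro w (rfl | hw) u (rfl | hu) x hx h1 h2 y hy
    · omega
    · have := hnew x hx
      have := hcut u hu
      omega
    · have := hnew y hy
      have := hold x (h.outs_subset w hw x hx)
      omega
    · have h3 := hold x (h.outs_subset w hw x hx)
      have h4 := hcut u hu
      have h5 := hcut w hw
      exact hmono y (h.outs_subset u hu y hy) x (h.outs_subset w hw x hx)
        (h.outs_nested w hw u hu x hx (by omega) (by omega) y hy)
  -- When exactly one of the two nodes is new, `gap` decides: it is applied to an input of the new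
  -- node, which stood in the old cross-section.
  case ins_nested =>
    rintro w (rfl | hw) u (rfl | hu) x hx h1 h2 y hy
    · omega
    · have h3 := hold x (hinS x hx)
      have h4 := hcut u hu
      have h5 := h.ins_subset u hu y hy
      refine hmono x (hinS x hx) y h5 ?_
      by_contra hlt
      have hne : pos x ≠ pos y := fun e =>
        h.notMem_ins x (by simp [hx]) u hu (h.injOn (hinS x hx) h5 e ▸ hy)
      have := h.gap u hu x (by simp [hx]) y hy (by omega)
      omega
    · have h3 := h.ins_subset w hw x hx
      have h4 := hold x h3
      have h5 := hcut w hw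
      have hne : pos x ≠ pos a := fun e =>
        h.notMem_ins a has w hw (h.injOn h3 haS e ▸ hx)
      have := h.gap w hw a has x hx (by omega)
      omega
    · have h3 := hold x (h.ins_subset w hw x hx)
      have h4 := hcut u hu
      have h5 := hcut w hw
      exact hmono x (h.ins_subset w hw x hx) y (h.ins_subset u hu y hy)
        (h.ins_nested w hw u hu x hx (by omega) (by omega) y hy)
  case gap =>
    rintro w hw x hx y hy hyx
    simp only [List.mem_append] at hx
    rcases hw with rfl | hw
    · rw [hcutv]
      have := hold y (hinS y hy)
      have := hins_le y hy
      rcases hx with (hx | hx) | hx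
      · have := hold x (hlS x hx)
        have := hl_lt x hx y hy
        omega
      · have := hnew x hx
        omega
      · have := hold x (hrS x hx)
        have := hr_lt x hx
        omega
    · have h1 := hold y (h.ins_subset w hw y hy)
      have h2 := hcut w hw
      have h3 : ∀ x ∈ l ++ G.ins v ++ r, pos y < pos x → cut w < pos x :=
        fun x hx => h.gap w hw x hx y hy
      rcases hx with (hx | hx) | hx
      · have := hold x (hlS x hx)
        have := h3 x (by simp [hx])
        omega
      -- A new edge inherits the property from `a`, directly after which it was inserted.
      · have := hnew x hx
        have := h3 a has
        have hne : pos y ≠ pos a := fun e =>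
          h.notMem_ins a has w hw (h.injOn (h.ins_subset w hw y hy) haS e ▸ hy)
        omega
      · have := hold x (hrS x hx)
        have := h3 x (by simp [hx])
        omega

theorem PartialOrderOn.sweep (hk : 0 < k) {G : PGraph k n} {s t : List (PEdge k n)}
    {vs : List (PNode n)} (hs : G.Sweep s vs t) (hnd : vs.Nodup) {U : Set (PNode n)}
    {S : Finset (PEdge k n)} {pos : PEdge k n → ℕ} {cut : PNode n → ℕ}
    (h : G.PartialOrderOn U S s pos cut) (hU : ∀ v ∈ vs, v ∉ U) :
    ∃ S' pos' cut', G.PartialOrderOn (U ∪ {v | v ∈ vs}) S' t pos' cut' := by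
  induction hs generalizing U S pos cut with
  | nil s => exact ⟨S, pos, cut, by simpa using h⟩
  | cons v vs l r t _ ih =>
    rw [List.nodup_cons] at hnd
    obtain ⟨S', pos', cut', h'⟩ := h.step hk (hU v (by simp))
    obtain ⟨S'', pos'', cut'', h''⟩ := ih hnd.2 h' (by
      rintro w hw (rfl | hwU)
      · exact hnd.1 hw
      · exact hU w (by simp [hw]) hwU)
    refine ⟨S'', pos'', cut'', ?_⟩
    convert h'' using 1
    ext w
    simp only [Set.mem_union, Set.mem_ofPred_eq, List.mem_cons, Set.mem_insert_iff]
    tauto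

/-! ### Depth-left orders of the whole graph -/

/-- The numbering `pos` of the edges from `0` to `(k + 1) * n` is a depth-left order: the last
input of the node `v` has the number `cut v` and its first output the number `cut v + 1`, and the
inputs and the outputs of different nodes are nested. -/
structure IsDepthLeftOrder (G : PGraph k n) (pos : PEdge k n → ℕ) (cut : PNode n → ℕ) :
    Prop where
  injective : Function.Injective pos
  pos_le : ∀ x, pos x ≤ (k + 1) * n
  pos_initial : pos G.initialEdge = 0
  pos_terminal : pos G.terminalEdge = (k + 1) * n
  ins_le : ∀ v, ∀ x ∈ G.ins v, pos x ≤ cut v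
  lt_outs : ∀ v, ∀ x ∈ G.outs v, cut v < pos x
  exists_in : ∀ v, ∃ x ∈ G.ins v, pos x = cut v
  exists_out : ∀ v, ∃ x ∈ G.outs v, pos x = cut v + 1
  ins_sorted : ∀ v, (G.ins v).Pairwise (pos · < pos ·)
  outs_sorted : ∀ v, (G.outs v).Pairwise (pos · < pos ·)
  outs_nested : ∀ v w, ∀ x ∈ G.outs v, cut v < cut w → cut w < pos x →
    ∀ y ∈ G.outs w, pos y < pos x
  ins_nested : ∀ v w, ∀ x ∈ G.ins v, cut w < cut v → pos x ≤ cut w →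
    ∀ y ∈ G.ins w, pos x < pos y

theorem IsComposition.exists_isDepthLeftOrder (hk : 0 < k) {G : PGraph k n}
    (h : G.IsComposition) : ∃ pos cut, G.IsDepthLeftOrder pos cut := by
  obtain ⟨vs, hnd, hall, hs⟩ := h
  have h0 : G.PartialOrderOn ∅ {G.initialEdge} [G.initialEdge] (fun _ => 0) fun _ => 0 := by
    constructor <;> simp
  obtain ⟨S, pos, cut, h⟩ := h0.sweep hk hs hnd (by simp)
  have hU : ∀ v, v ∈ (∅ ∪ {v | v ∈ vs} : Set (PNode n)) := fun v => Or.inr (hall v)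
  have hS : ∀ x, x ∈ S := fun x => by
    cases hx : G.tail x with
    | none => exact eq_initialEdge_of_tail hx ▸ h.initial_mem
    | some v => exact h.outs_subset v (hU v) x (mem_outs.2 hx)
  -- Once all nodes are swept, every edge is numbered, being the initial edge or an output of some
  -- node.
  have hcard : S.card = (k + 1) * n + 1 := by
    rw [Finset.eq_univ_iff_forall.2 hS, Finset.card_univ, Fintype.card_fin]
  refine ⟨pos, cut, ?_⟩
  constructor
  case injective => exact fun x y hxy => h.injOn (hS x) (hS y) hxy
  case pos_le => exact fun x => by have := h.pos_lt x (hS x); omega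
  case pos_initial => exact h.pos_initial
  case pos_terminal =>
    obtain ⟨x, hx, hxc⟩ := h.exists_last
    rw [List.mem_singleton.1 hx] at hxc
    omega
  case ins_le => exact fun v => h.ins_le v (hU v)
  case lt_outs => exact fun v => h.lt_outs v (hU v)
  case exists_in => exact fun v => h.exists_in v (hU v)
  case exists_out => exact fun v => h.exists_out v (hU v)
  case ins_sorted => exact fun v => h.ins_sorted v (hU v)
  case outs_sorted => exact fun v => h.outs_sorted v (hU v)
  case outs_nested => exact fun v w => h.outs_nested v (hU v) w (hU w)
  case ins_nested => exact fun v w => h.ins_nested v (hU v) w (hU w)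

end PGraph

/-! ### The search follows every depth-left order -/

theorem List.findSome?_eq_some_of_sorted {α β : Type*} (pos : α → ℕ) (f : α → Option β)
    {L : List α} (hL : L.Pairwise (pos · > pos ·)) {a : α} {b : β} (ha : a ∈ L)
    (hab : f a = some b) (h : ∀ e ∈ L, pos a < pos e → f e = none) : L.findSome? f = some b := by
  induction L with
  | nil => cases ha
  | cons c L ih =>
    rw [List.pairwise_cons] at hL
    rcases List.mem_cons.1 ha with rfl | ha
    · rw [List.findSome?_cons, hab]
    · rw [List.findSome?_cons, h c (by simp) (hL.1 a ha)]
      exact ih hL.2 ha fun e he => h e (by simp [he])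

theorem List.find?_eq_some_of_sorted {α : Type*} (pos : α → ℕ) (p : α → Bool)
    {L : List α} (hL : L.Pairwise (pos · < pos ·)) {a : α} (ha : a ∈ L)
    (hpa : p a = true) (h : ∀ e ∈ L, pos e < pos a → p e = false) : L.find? p = some a := by
  induction L with
  | nil => cases ha
  | cons c L ih =>
    rw [List.pairwise_cons] at hL
    rcases List.mem_cons.1 ha with rfl | ha
    · rw [List.find?_cons, hpa]
    · rw [List.find?_cons, h c (by simp) (hL.1 a ha)]
      exact ih hL.2 ha fun e he => h e (by simp [he])

namespace PGraph

variable {k n : ℕ} {G : PGraph k n} {pos : PEdge k n → ℕ} {cut : PNode n → ℕ}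

namespace IsDepthLeftOrder

theorem exists_pos_eq (h : G.IsDepthLeftOrder pos cut) {i : ℕ} (hi : i ≤ (k + 1) * n) :
    ∃ x, pos x = i := by
  let f : PEdge k n → PEdge k n := fun x => ⟨pos x, Nat.lt_succ_of_le (h.pos_le x)⟩
  have hf : Function.Injective f := fun x y hxy => h.injective (congrArg Fin.val hxy)
  obtain ⟨x, hx⟩ := Finite.surjective_of_injective hf ⟨i, Nat.lt_succ_of_le hi⟩
  exact ⟨x, congrArg Fin.val hx⟩

/-- The node `v` from which `b` starts is available, since its inputs are numbered at most `cut v <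
pos b`. No higher labelled edge ends at an available node, by nesting of outputs; and the outputs of
`v` to the left of `b` have smaller numbers, so they are labelled already. -/
theorem nextEdge_eq (h : G.IsDepthLeftOrder pos cut) {L : List (PEdge k n)} {i : ℕ}
    (hL : L.Pairwise (pos · > pos ·)) (hmem : ∀ x, x ∈ L ↔ pos x ≤ i) {b : PEdge k n}
    (hb : pos b = i + 1) : G.nextEdge L = some b := by
  cases hv : G.tail b with
  | none =>
    rw [eq_initialEdge_of_tail hv, h.pos_initial] at hb
    omega
  | some v =>
    have hbv := mem_outs.2 hv
    obtain ⟨a, ha, hac⟩ := h.exists_in v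
    have hcb := h.lt_outs v b hbv
    refine List.findSome?_eq_some_of_sorted pos _ hL (a := a) ((hmem a).2 (by omega)) ?_ ?_
    · rw [mem_ins.1 ha, Option.bind_some, if_pos]
      · refine List.find?_eq_some_of_sorted pos _ (h.outs_sorted v) hbv ?_ fun e _ hlt => ?_
        · simp [hmem, hb]
        · simp [hmem]
          omega
      · intro x hx
        have := h.ins_le v x hx
        exact (hmem x).2 (by omega)
    · intro e he hlt
      cases hw : G.head e with
      | none => rfl
      | some w =>
        rw [Option.bind_some]
        split_ifs with hall
        · obtain ⟨z, hz, hzc⟩ := h.exists_in w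
          have h1 := (hmem z).1 (hall z hz)
          have h2 := h.ins_le w e (mem_ins.2 hw)
          rw [List.find?_eq_none]
          intro y hy
          have := h.outs_nested v w b hbv (by omega) (by omega) y hy
          simp [hmem]
          omega
        · rfl

theorem searchList_spec (h : G.IsDepthLeftOrder pos cut) {i : ℕ} (hi : i ≤ (k + 1) * n) :
    (G.searchList i).map pos = (List.range (i + 1)).reverse := by
  induction i with
  | zero => simp [searchList, h.pos_initial]
  | succ i ih =>
    have ih := ih (by omega)
    obtain ⟨b, hb⟩ := h.exists_pos_eq hi
    have hmem : ∀ x, x ∈ G.searchList i ↔ pos x ≤ i := fun x => by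
      rw [← List.mem_map_of_injective h.injective, ih]
      simp
    have hsort : (G.searchList i).Pairwise (pos · > pos ·) := by
      rw [← List.pairwise_map (R := (· > ·)), ih, List.pairwise_reverse]
      exact List.pairwise_lt_range
    rw [searchList, h.nextEdge_eq hsort hmem hb, List.range_succ, List.reverse_append, ← ih, ← hb]
    rfl

theorem edgeLabel_eq (h : G.IsDepthLeftOrder pos cut) : G.edgeLabel = pos := by
  funext e
  have hs := congrArg List.reverse (h.searchList_spec le_rfl)
  rw [← List.map_reverse, List.reverse_reverse] at hs
  have hlen : (G.searchList ((k + 1) * n)).reverse.length = (k + 1) * n + 1 := by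
    rw [← List.length_map (f := pos), hs, List.length_range]
  have he : e ∈ (G.searchList ((k + 1) * n)).reverse := by
    rw [← List.mem_map_of_injective h.injective, hs, List.mem_range]
    exact Nat.lt_succ_of_le (h.pos_le e)
  have hlt := List.idxOf_lt_length_of_mem he
  have hget := List.getElem_idxOf hlt
  have := List.getElem_map (f := pos) (l := (G.searchList ((k + 1) * n)).reverse)
    (i := (G.searchList ((k + 1) * n)).reverse.idxOf e) (h := by simpa using hlt)
  simp only [hs, List.getElem_range, hget] at this
  exact this

/-- The conditions are self-dual. The first output of a node, numbered `cut + 1`, becomes its last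
input, numbered `(k + 1) * n - (cut + 1)`; this is the new cut. -/
theorem rotate (h : G.IsDepthLeftOrder pos cut) :
    G.rotate.IsDepthLeftOrder (fun x => (k + 1) * n - pos x)
      (fun v => (k + 1) * n - 1 - cut v.rotate) := by
  have hle := h.pos_le
  have hcut : ∀ v, cut v + 1 ≤ (k + 1) * n := fun v => by
    obtain ⟨x, _, hx⟩ := h.exists_out v
    exact hx ▸ hle x
  have hins : ∀ v, G.rotate.ins v = (G.outs v.rotate).reverse := fun v => by
    rw [← ins_rotate, PNode.rotate_rotate]
  have houts : ∀ v, G.rotate.outs v = (G.ins v.rotate).reverse := fun v => by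
    rw [← outs_rotate, PNode.rotate_rotate]
  constructor
  case injective =>
    intro x y hxy
    have := hle x
    have := hle y
    exact h.injective (by simp only at hxy; omega)
  case pos_le => exact fun x => Nat.sub_le _ _
  case pos_initial =>
    have : G.rotate.initialEdge = G.terminalEdge := rfl
    rw [this, h.pos_terminal, Nat.sub_self]
  case pos_terminal =>
    have : G.rotate.terminalEdge = G.initialEdge := rfl
    rw [this, h.pos_initial, Nat.sub_zero]
  case ins_le =>
    intro v x hx
    rw [hins, List.mem_reverse] at hx
    have := h.lt_outs _ x hx
    omega
  case lt_outs =>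
    intro v x hx
    rw [houts, List.mem_reverse] at hx
    have := h.ins_le _ x hx
    have := hcut v.rotate
    omega
  case exists_in =>
    intro v
    obtain ⟨x, hx, hxc⟩ := h.exists_out v.rotate
    exact ⟨x, by rwa [hins, List.mem_reverse], by omega⟩
  case exists_out =>
    intro v
    obtain ⟨x, hx, hxc⟩ := h.exists_in v.rotate
    have := hcut v.rotate
    exact ⟨x, by rwa [houts, List.mem_reverse], by omega⟩
  case ins_sorted =>
    intro v
    rw [hins, List.pairwise_reverse]
    exact (h.outs_sorted _).imp fun {x y} hxy => by
      have := hle x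
      have := hle y
      omega
  case outs_sorted =>
    intro v
    rw [houts, List.pairwise_reverse]
    exact (h.ins_sorted _).imp fun {x y} hxy => by
      have := hle x
      have := hle y
      omega
  case outs_nested =>
    intro v w x hx h1 h2 y hy
    rw [houts, List.mem_reverse] at hx hy
    have := hcut v.rotate
    have := hcut w.rotate
    have := h.ins_nested v.rotate w.rotate x hx (by omega) (by omega) y hy
    have := hle y
    omega
  case ins_nested =>
    intro v w x hx h1 h2 y hy
    rw [hins, List.mem_reverse] at hx hy
    have := hcut v.rotate
    have := hcut w.rotate
    have := hle x
    have := h.outs_nested v.rotate w.rotate x hx (by omega) (by omega) y hy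
    omega

end IsDepthLeftOrder

end PGraph

/-! ### Set-valued tableaux -/

theorem SetFilling.IsStandard.mem_range_schutzenberger {m n : ℕ} {ρ : Fin m → ℕ}
    {T : SetFilling m n} (h : T.IsStandard ρ) {i : Fin m} {j : Fin n} {a : ℕ}
    (ha : a ∈ schutzenberger ρ T i j) : 1 ≤ a ∧ a ≤ n * ∑ i, ρ i := by
  obtain ⟨b, hb, rfl⟩ := Finset.mem_image.1 ha
  have := h.mem_range _ _ b hb
  omega

theorem SetFilling.IsStandard.mem_schutzenberger {m n : ℕ} {ρ : Fin m → ℕ} {T : SetFilling m n}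
    (h : T.IsStandard ρ) {i : Fin m} {j : Fin n} {a : ℕ} (haM : a ≤ n * ∑ i, ρ i) :
    a ∈ schutzenberger ρ T i j ↔ n * ∑ i, ρ i + 1 - a ∈ T i.rev j.rev := by
  rw [schutzenberger, Finset.mem_image]
  constructor
  · rintro ⟨b, hb, rfl⟩
    have := h.mem_range _ _ b hb
    rwa [show n * ∑ i, ρ i + 1 - (n * ∑ i, ρ i + 1 - b) = b by omega]
  · exact fun hb => ⟨_, hb, by omega⟩

/-- Rotation and complementation each reverse the inequalities between neighbouring cells. The
symmetry of `ρ` serves for the cell sizes. -/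
theorem SetFilling.IsStandard.schutzenberger {m n : ℕ} {ρ : Fin m → ℕ} (hρ : ∀ i, ρ i.rev = ρ i)
    {T : SetFilling m n} (h : T.IsStandard ρ) : (schutzenberger ρ T).IsStandard ρ := by
  constructor
  case mem_range => exact fun i j a ha => h.mem_range_schutzenberger ha
  case existsUnique_cell =>
    intro a ha haM
    obtain ⟨c, hc, huniq⟩ := h.existsUnique_cell (n * ∑ i, ρ i + 1 - a) (by omega) (by omega)
    refine ⟨(c.1.rev, c.2.rev), ?_, fun d hd => ?_⟩
    · simpa [h.mem_schutzenberger haM] using hc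
    · have := huniq (d.1.rev, d.2.rev) ((h.mem_schutzenberger haM).1 hd)
      rw [← this]
      simp
  case card_cell =>
    intro i j
    rw [_root_.schutzenberger, Finset.card_image_of_injOn, h.card_cell, hρ]
    intro x hx y hy hxy
    have := h.mem_range _ _ x hx
    have := h.mem_range _ _ y hy
    simp only at hxy
    omega
  case row_lt =>
    intro i j j' hj a ha b hb
    have h1 := h.mem_range_schutzenberger ha
    have h2 := h.mem_range_schutzenberger hb
    have := h.row_lt i.rev j'.rev j.rev (by simp only [Fin.val_rev]; omega) _
      ((h.mem_schutzenberger h2.2).1 hb) _ ((h.mem_schutzenberger h1.2).1 ha)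
    omega
  case col_lt =>
    intro i i' j hi a ha b hb
    have h1 := h.mem_range_schutzenberger ha
    have h2 := h.mem_range_schutzenberger hb
    have := h.col_lt i'.rev i.rev j.rev (by simp only [Fin.val_rev]; omega) _
      ((h.mem_schutzenberger h2.2).1 hb) _ ((h.mem_schutzenberger h1.2).1 ha)
    omega

theorem rowDensity_rev (k : ℕ) (i : Fin 3) : rowDensity k i.rev = rowDensity k i := by
  fin_cases i <;> rfl

theorem rowDensity_pos {k : ℕ} (hk : 2 ≤ k) (i : Fin 3) : 0 < rowDensity k i := by
  fin_cases i <;> simp [rowDensity]; omega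

theorem sum_rowDensity {k : ℕ} (hk : 2 ≤ k) (n : ℕ) :
    n * ∑ i, rowDensity k i = (k + 1) * n := by
  rw [mul_comm]
  congr 1
  simp only [rowDensity, Fin.sum_univ_three, Matrix.cons_val]
  omega

/-! ### Blocks of a finite set of integers -/

/-- The number of elements of `R` below `a`. -/
def rankIn (R : Finset ℕ) (a : ℕ) : ℕ := (R.filter fun b => b < a).card

theorem mem_blockOf {R : Finset ℕ} {d j a : ℕ} : a ∈ blockOf R d j ↔ a ∈ R ∧ rankIn R a / d = j :=
  Finset.mem_filter

theorem rankIn_mono (R : Finset ℕ) {a b : ℕ} (h : a ≤ b) : rankIn R a ≤ rankIn R b :=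
  Finset.card_le_card fun x hx => by
    rw [Finset.mem_filter] at hx ⊢
    exact ⟨hx.1, hx.2.trans_le h⟩

theorem rankIn_lt_rankIn {R : Finset ℕ} {a b : ℕ} (ha : a ∈ R) (h : a < b) :
    rankIn R a < rankIn R b := by
  refine Finset.card_lt_card ((Finset.ssubset_iff_of_subset fun x hx => ?_).2 ⟨a, ?_, ?_⟩)
  · rw [Finset.mem_filter] at hx ⊢
    exact ⟨hx.1, hx.2.trans h⟩
  · exact Finset.mem_filter.2 ⟨ha, h⟩
  · simp

theorem rankIn_lt_card {R : Finset ℕ} {a : ℕ} (ha : a ∈ R) : rankIn R a < R.card :=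
  Finset.card_lt_card (Finset.filter_ssubset.2 ⟨a, ha, lt_irrefl a⟩)

theorem card_filter_le {R : Finset ℕ} {a : ℕ} (ha : a ∈ R) :
    (R.filter fun b => b ≤ a).card = rankIn R a + 1 := by
  rw [rankIn, ← Finset.card_insert_of_notMem (a := a) (by simp)]
  congr 1
  ext x
  simp only [Finset.mem_filter, Finset.mem_insert, le_iff_lt_or_eq]
  constructor
  · rintro ⟨h1, h2 | h2⟩
    · exact Or.inr ⟨h1, h2⟩
    · exact Or.inl h2
  · rintro (rfl | ⟨h1, h2⟩)
    · exact ⟨ha, Or.inr rfl⟩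
    · exact ⟨h1, Or.inl h2⟩

theorem rankIn_injOn (R : Finset ℕ) : Set.InjOn (rankIn R) R := by
  intro a ha b hb hab
  rcases lt_trichotomy a b with h | h | h
  · exact absurd hab (rankIn_lt_rankIn ha h).ne
  · exact h
  · exact absurd hab (rankIn_lt_rankIn hb h).ne'

theorem image_rankIn (R : Finset ℕ) : R.image (rankIn R) = Finset.range R.card := by
  refine Finset.eq_of_subset_of_card_le (fun x hx => ?_) ?_
  · obtain ⟨a, ha, rfl⟩ := Finset.mem_image.1 hx
    exact Finset.mem_range.2 (rankIn_lt_card ha)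
  · rw [Finset.card_image_of_injOn (rankIn_injOn R), Finset.card_range]

/-- The ranks of the elements of the block fill the interval from `j * d` to `(j + 1) * d - 1`. -/
theorem card_blockOf {R : Finset ℕ} {d n j : ℕ} (hd : 0 < d) (hR : R.card = n * d) (hj : j < n) :
    (blockOf R d j).card = d := by
  have himage : (blockOf R d j).image (rankIn R) = Finset.Ico (j * d) ((j + 1) * d) := by
    ext t
    rw [Finset.mem_image, Finset.mem_Ico]
    constructor
    · rintro ⟨a, ha, rfl⟩
      obtain ⟨_, h⟩ := mem_blockOf.1 ha
      rw [Nat.div_eq_iff hd] at h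
      rw [add_mul, one_mul]
      omega
    · intro ht
      have htR : t ∈ R.image (rankIn R) := by
        rw [image_rankIn, Finset.mem_range, hR]
        exact ht.2.trans_le (Nat.mul_le_mul_right d hj)
      obtain ⟨a, ha, rfl⟩ := Finset.mem_image.1 htR
      refine ⟨a, mem_blockOf.2 ⟨ha, ?_⟩, rfl⟩
      rw [Nat.div_eq_iff hd]
      rw [add_mul, one_mul] at ht
      omega
  have hinj : Set.InjOn (rankIn R) (blockOf R d j) :=
    (rankIn_injOn R).mono (Finset.filter_subset _ _)
  rw [← Finset.card_image_of_injOn hinj, himage, Nat.card_Ico, add_mul, one_mul, Nat.add_sub_cancel_left]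

theorem rankIn_reflect {R : Finset ℕ} {M a : ℕ} (hM : ∀ x ∈ R, x ≤ M) (ha : a ∈ R) :
    rankIn (R.image fun x => M - x) (M - a) + rankIn R a + 1 = R.card := by
  have h1 : rankIn (R.image fun x => M - x) (M - a) = (R.filter fun b => ¬ b ≤ a).card := by
    rw [rankIn, Finset.filter_image, Finset.card_image_of_injOn]
    · congr 1
      refine Finset.filter_congr fun x hx => ?_
      have := hM x hx
      have := hM a ha
      omega
    · intro x hx y hy hxy
      have := hM x (Finset.mem_filter.1 hx).1
      have := hM y (Finset.mem_filter.1 hy).1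
      simp only at hxy
      omega
  rw [h1, add_assoc, ← card_filter_le ha, add_comm, Finset.card_filter_add_card_filter_not]

/-- Reflection turns the rank `r` into `n * d - 1 - r`, whose quotient by `d` is `n - 1 - r / d`.
This uses that all `n` blocks are full. -/
theorem blockOf_reflect {R : Finset ℕ} {d n M : ℕ} (hd : 0 < d) (hR : R.card = n * d)
    (hM : ∀ x ∈ R, x ≤ M) (j : Fin n) :
    blockOf (R.image fun x => M - x) d j = (blockOf R d j.rev).image fun x => M - x := by
  have key : ∀ a ∈ R, rankIn (R.image fun x => M - x) (M - a) / d = j ↔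
      rankIn R a / d = j.rev := by
    intro a ha
    have h1 := rankIn_reflect hM ha
    rw [Nat.div_eq_iff hd, Nat.div_eq_iff hd, Fin.val_rev, Nat.sub_mul, add_mul, one_mul]
    have h2 : (j.val + 1) * d ≤ n * d := Nat.mul_le_mul_right d j.isLt
    rw [add_mul, one_mul] at h2
    omega
  ext y
  rw [mem_blockOf, Finset.mem_image, Finset.mem_image]
  constructor
  · rintro ⟨⟨a, ha, rfl⟩, h⟩
    exact ⟨a, mem_blockOf.2 ⟨ha, (key a ha).1 h⟩, rfl⟩
  · rintro ⟨a, ha, rfl⟩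
    obtain ⟨ha, h⟩ := mem_blockOf.1 ha
    exact ⟨⟨a, ha, rfl⟩, (key a ha).2 h⟩

/-! ### The rows of the tableau -/

theorem PGraph.rotate_rotate {k n : ℕ} (G : PGraph k n) : G.rotate.rotate = G := by
  cases G
  simp [PGraph.rotate, Equiv.trans_assoc]

namespace PGraph.IsDepthLeftOrder

variable {k n : ℕ} {G : PGraph k n} {pos : PEdge k n → ℕ} {cut : PNode n → ℕ}

theorem cut_injective (h : G.IsDepthLeftOrder pos cut) : Function.Injective cut := by
  intro v w hvw
  obtain ⟨x, hx, hxc⟩ := h.exists_out v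
  obtain ⟨y, hy, hyc⟩ := h.exists_out w
  have hxy : x = y := h.injective (by omega)
  rw [mem_outs] at hx hy
  rw [hxy, hy] at hx
  exact (Option.some.inj hx).symm

theorem pos_prOut (h : G.IsDepthLeftOrder pos cut) (p : Fin n) :
    pos (G.src.symm (PSource.prOut p)) = cut (PNode.product p) + 1 := by
  obtain ⟨x, hx, hxc⟩ := h.exists_out (PNode.product p)
  rw [outs, List.mem_singleton] at hx
  rw [← hx, hxc]

theorem pos_coOut_eq_iff (h : G.IsDepthLeftOrder pos cut) (c : Fin n) (j : Fin k) :
    pos (G.src.symm (PSource.coOut c j)) = cut (PNode.coproduct c) + 1 ↔ j.val = 0 := by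
  obtain ⟨x, hx, hxc⟩ := h.exists_out (PNode.coproduct c)
  have hsort := h.outs_sorted (PNode.coproduct c)
  simp only [outs, List.pairwise_ofFn] at hsort
  simp only [outs, List.mem_ofFn] at hx
  obtain ⟨i, rfl⟩ := hx
  have hi : i.val = 0 := by
    by_contra hi
    have h1 := hsort (i := ⟨0, by omega⟩) (j := i) (Nat.pos_of_ne_zero hi)
    have h2 := h.lt_outs (PNode.coproduct c) (G.src.symm (PSource.coOut c ⟨0, by omega⟩))
      (by simp [outs, List.mem_ofFn])
    omega
  constructor
  · intro hj
    have := h.injective (hj.trans hxc.symm)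
    simp only [EmbeddingLike.apply_eq_iff_eq, PSource.coOut.injEq, true_and] at this
    rw [this, hi]
  · intro hj
    rw [← hxc, Fin.ext (hj.trans hi.symm)]

theorem mem_rowLabels (h : G.IsDepthLeftOrder pos cut) {i : Fin 3} {a : ℕ} :
    a ∈ G.rowLabels i ↔ ∃ x, G.edgeRow (G.src.symm x) = some i ∧ pos (G.src.symm x) = a := by
  simp only [rowLabels, h.edgeLabel_eq, Finset.mem_image, Finset.mem_filter, Finset.mem_univ,
    true_and]
  exact ⟨fun ⟨e, he⟩ => ⟨G.src e, by simpa using he⟩, fun ⟨x, hx⟩ => ⟨_, hx⟩⟩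

theorem rowLabels_zero (hk : 0 < k) (h : G.IsDepthLeftOrder pos cut) :
    G.rowLabels 0 = Finset.univ.image fun c => cut (PNode.coproduct c) + 1 := by
  ext a
  rw [h.mem_rowLabels, Finset.mem_image]
  constructor
  · rintro ⟨_ | ⟨c, j⟩ | p, hx, rfl⟩
    · simp [edgeRow] at hx
    · refine ⟨c, Finset.mem_univ _, ((h.pos_coOut_eq_iff c j).2 ?_).symm⟩
      by_contra hj
      simp [edgeRow, hj] at hx
    · simp [edgeRow] at hx
  · rintro ⟨c, -, rfl⟩
    exact ⟨PSource.coOut c ⟨0, hk⟩, by simp [edgeRow], (h.pos_coOut_eq_iff c _).2 rfl⟩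

theorem rowLabels_two (h : G.IsDepthLeftOrder pos cut) :
    G.rowLabels 2 = Finset.univ.image fun p => cut (PNode.product p) + 1 := by
  ext a
  rw [h.mem_rowLabels, Finset.mem_image]
  constructor
  · rintro ⟨_ | ⟨c, j⟩ | p, hx, rfl⟩
    · simp [edgeRow] at hx
    · simp only [edgeRow, Equiv.apply_symm_apply] at hx
      split_ifs at hx <;> simp at hx
    · exact ⟨p, Finset.mem_univ _, (h.pos_prOut p).symm⟩
  · rintro ⟨p, -, rfl⟩
    exact ⟨PSource.prOut p, by simp [edgeRow], h.pos_prOut p⟩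

theorem mem_Icc_of_mem_rowLabels (h : G.IsDepthLeftOrder pos cut) {i : Fin 3} {a : ℕ}
    (ha : a ∈ G.rowLabels i) : 1 ≤ a ∧ a ≤ (k + 1) * n := by
  obtain ⟨x, hx, rfl⟩ := h.mem_rowLabels.1 ha
  refine ⟨?_, h.pos_le _⟩
  by_contra h0
  have h1 : pos (G.src.symm x) = pos G.initialEdge := by
    rw [h.pos_initial]
    omega
  rw [h.injective h1] at hx
  simp [edgeRow, initialEdge] at hx

theorem existsUnique_rowLabels (h : G.IsDepthLeftOrder pos cut) {a : ℕ} (ha : 1 ≤ a)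
    (haN : a ≤ (k + 1) * n) : ∃! i, a ∈ G.rowLabels i := by
  obtain ⟨e, rfl⟩ := h.exists_pos_eq haN
  obtain ⟨x, rfl⟩ := G.src.symm.surjective e
  have hiff : ∀ i, pos (G.src.symm x) ∈ G.rowLabels i ↔ G.edgeRow (G.src.symm x) = some i := by
    intro i
    rw [h.mem_rowLabels]
    refine ⟨?_, fun hx => ⟨x, hx, rfl⟩⟩
    rintro ⟨y, hy, hyx⟩
    rwa [← h.injective hyx]
  simp only [hiff]
  cases hrow : G.edgeRow (G.src.symm x) with
  | none =>
    exfalso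
    rcases x with _ | ⟨c, j⟩ | p
    · have := h.pos_initial
      rw [initialEdge] at this
      omega
    · simp only [edgeRow, Equiv.apply_symm_apply] at hrow
      split_ifs at hrow
    · simp [edgeRow] at hrow
  | some i => exact ⟨i, rfl, fun j hj => (Option.some.inj hj).symm⟩

/-- The middle labels have no direct expression through `cut`; as a complement they can be reflected
along with the other two rows. -/
theorem rowLabels_one (h : G.IsDepthLeftOrder pos cut) :
    G.rowLabels 1 = Finset.Icc 1 ((k + 1) * n) \ (G.rowLabels 0 ∪ G.rowLabels 2) := by
  ext a
  rw [Finset.mem_sdiff, Finset.mem_union, Finset.mem_Icc]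
  constructor
  · intro ha
    have h1 := h.mem_Icc_of_mem_rowLabels ha
    have huniq : ∀ {j}, a ∈ G.rowLabels j → 1 = j :=
      (h.existsUnique_rowLabels h1.1 h1.2).unique ha
    exact ⟨h1, fun h2 => h2.elim (fun h2 => by simpa using huniq h2)
      fun h2 => by simpa using huniq h2⟩
  · rintro ⟨⟨h1, h2⟩, h3⟩
    obtain ⟨i, hi, -⟩ := h.existsUnique_rowLabels h1 h2
    fin_cases i
    · exact absurd (Or.inl hi) h3
    · exact hi
    · exact absurd (Or.inr hi) h3

theorem card_rowLabels (hk : 2 ≤ k) (h : G.IsDepthLeftOrder pos cut) (i : Fin 3) :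
    (G.rowLabels i).card = n * rowDensity k i := by
  have h0 : (G.rowLabels 0).card = n := by
    rw [h.rowLabels_zero (by omega), Finset.card_image_of_injective, Finset.card_fin]
    intro c d hcd
    simpa using h.cut_injective (Nat.succ_injective hcd)
  have h2 : (G.rowLabels 2).card = n := by
    rw [h.rowLabels_two, Finset.card_image_of_injective, Finset.card_fin]
    intro c d hcd
    simpa using h.cut_injective (Nat.succ_injective hcd)
  fin_cases i
  · simpa [rowDensity] using h0
  · change (G.rowLabels 1).card = n * (k - 1)
    have hdisj : Disjoint (G.rowLabels 0) (G.rowLabels 2) := by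
      rw [Finset.disjoint_left]
      intro a ha ha'
      have h1 := h.mem_Icc_of_mem_rowLabels ha
      simpa using (h.existsUnique_rowLabels h1.1 h1.2).unique ha ha'
    rw [h.rowLabels_one, Finset.card_sdiff_of_subset, Finset.card_union_of_disjoint hdisj, h0, h2,
      Nat.card_Icc, Nat.mul_sub, mul_one, add_mul, one_mul, mul_comm k n]
    · omega
    · intro a ha
      rw [Finset.mem_Icc]
      exact (Finset.mem_union.1 ha).elim h.mem_Icc_of_mem_rowLabels h.mem_Icc_of_mem_rowLabels
  · simpa [rowDensity] using h2

theorem rowLabels_rotate (hk : 0 < k) (h : G.IsDepthLeftOrder pos cut) (i : Fin 3) :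
    G.rotate.rowLabels i = (G.rowLabels i.rev).image fun a => (k + 1) * n + 1 - a := by
  have hcut : ∀ v, cut v + 1 ≤ (k + 1) * n := fun v => by
    obtain ⟨x, _, hx⟩ := h.exists_out v
    exact hx ▸ h.pos_le x
  have h0 : G.rotate.rowLabels 0 = (G.rowLabels 2).image fun a => (k + 1) * n + 1 - a := by
    rw [h.rotate.rowLabels_zero hk, h.rowLabels_two, Finset.image_image]
    refine Finset.image_congr fun c _ => ?_
    have := hcut (PNode.product c)
    simp only [PNode.rotate, Function.comp_apply]
    omega
  have h2 : G.rotate.rowLabels 2 = (G.rowLabels 0).image fun a => (k + 1) * n + 1 - a := by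
    rw [h.rotate.rowLabels_two, h.rowLabels_zero hk, Finset.image_image]
    refine Finset.image_congr fun c _ => ?_
    have := hcut (PNode.coproduct c)
    simp only [PNode.rotate, Function.comp_apply]
    omega
  have hreflect : ∀ {j a}, 1 ≤ a → a ≤ (k + 1) * n →
      (a ∈ (G.rowLabels j).image (fun a => (k + 1) * n + 1 - a) ↔
        (k + 1) * n + 1 - a ∈ G.rowLabels j) := by
    intro j a ha haN
    rw [Finset.mem_image]
    constructor
    · rintro ⟨b, hb, rfl⟩
      have := h.mem_Icc_of_mem_rowLabels hb
      rwa [show (k + 1) * n + 1 - ((k + 1) * n + 1 - b) = b by omega]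
    · exact fun hb => ⟨_, hb, by omega⟩
  fin_cases i
  · exact h0
  · change G.rotate.rowLabels 1 = (G.rowLabels 1).image _
    ext a
    by_cases ha : 1 ≤ a ∧ a ≤ (k + 1) * n
    · rw [h.rotate.rowLabels_one, hreflect ha.1 ha.2, h.rowLabels_one]
      simp only [h0, h2, Finset.mem_sdiff, Finset.mem_union, hreflect ha.1 ha.2, Finset.mem_Icc,
        ha, true_and]
      rw [or_comm, iff_and_self]
      omega
    · refine iff_of_false (fun h' => ha (h.rotate.mem_Icc_of_mem_rowLabels h')) fun h' => ha ?_
      obtain ⟨b, hb, rfl⟩ := Finset.mem_image.1 h'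
      have := h.mem_Icc_of_mem_rowLabels hb
      omega
  · exact h2

theorem tableau_rotate (hk : 2 ≤ k) (h : G.IsDepthLeftOrder pos cut) :
    G.rotate.tableau = schutzenberger (rowDensity k) G.tableau := by
  funext i j
  simp only [tableau, schutzenberger, sum_rowDensity hk, h.rowLabels_rotate (by omega : 0 < k)]
  rw [blockOf_reflect (n := n) (rowDensity_pos hk i)
    ((h.card_rowLabels hk _).trans (by rw [rowDensity_rev])), rowDensity_rev]
  intro x hx
  have := h.mem_Icc_of_mem_rowLabels hx
  omega

/-! ### Standardness of the tableau -/

/-- Every middle label is preceded by sufficiently many top labels. -/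
theorem rankIn_one_lt (hk : 0 < k) (h : G.IsDepthLeftOrder pos cut) {b : ℕ}
    (hb : b ∈ G.rowLabels 1) :
    rankIn (G.rowLabels 1) b < rankIn (G.rowLabels 0) b * (k - 1) := by
  let t : Finset (Fin n) := Finset.univ.filter fun c => cut (PNode.coproduct c) + 1 < b
  have ht : rankIn (G.rowLabels 0) b = t.card := by
    rw [rankIn, h.rowLabels_zero hk, Finset.filter_image, Finset.card_image_of_injective]
    intro c d hcd
    simpa using h.cut_injective (Nat.succ_injective hcd)
  let J : Finset (Fin k) := Finset.univ.erase ⟨0, hk⟩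
  have hJ : J.card = k - 1 := by
    rw [Finset.card_erase_of_mem (Finset.mem_univ _), Finset.card_fin]
  -- Counting `b` itself gives the strict inequality: each middle label up to `b` is one of the `k -
  -- 1` further outputs of a coproduct whose leftmost output is labelled below `b`.
  rw [← Nat.succ_le_iff, Nat.succ_eq_add_one, ← card_filter_le hb, ht, ← hJ,
    ← Finset.card_product]
  refine (Finset.card_le_card ?_).trans
    (Finset.card_image_le (f := fun x => pos (G.src.symm (PSource.coOut x.1 x.2))))
  intro a ha
  rw [Finset.mem_filter, h.mem_rowLabels] at ha
  obtain ⟨⟨x, hx, rfl⟩, hle⟩ := ha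
  rcases x with _ | ⟨c, j⟩ | p
  · simp [edgeRow] at hx
  · simp only [edgeRow, Equiv.apply_symm_apply] at hx
    have hj : j.val ≠ 0 := fun hj => by simp [hj] at hx
    refine Finset.mem_image.2 ⟨(c, j), Finset.mem_product.2 ⟨?_, ?_⟩, rfl⟩
    · have h1 := h.lt_outs (PNode.coproduct c) (G.src.symm (PSource.coOut c j))
        (by simp [outs, List.mem_ofFn])
      have h2 := mt (h.pos_coOut_eq_iff c j).1 hj
      simp only [t, Finset.mem_filter, Finset.mem_univ, true_and]
      omega
    · exact Finset.mem_erase.2 ⟨fun e => hj (congrArg Fin.val e), Finset.mem_univ _⟩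
  · simp [edgeRow] at hx

theorem tableau_zero_lt_one (hk : 2 ≤ k) (h : G.IsDepthLeftOrder pos cut) (j : Fin n) {a b : ℕ}
    (ha : a ∈ G.tableau 0 j) (hb : b ∈ G.tableau 1 j) : a < b := by
  obtain ⟨-, ha⟩ := mem_blockOf.1 ha
  obtain ⟨hb, hbj⟩ := mem_blockOf.1 hb
  change _ / 1 = _ at ha
  rw [Nat.div_one] at ha
  have h1 := h.rankIn_one_lt (by omega) hb
  have h2 : rankIn (G.rowLabels 1) b / (k - 1) < rankIn (G.rowLabels 0) b :=
    Nat.div_lt_of_lt_mul (by rwa [mul_comm])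
  change _ / (k - 1) = _ at hbj
  -- If `b ≤ a`, then at most `j` top labels lie below `b`, because `a` has rank `j`; but the count
  -- gives more than `j`.
  by_contra hlt
  have := rankIn_mono (G.rowLabels 0) (not_lt.1 hlt)
  omega

theorem isStandard_tableau (hk : 2 ≤ k) (h : G.IsDepthLeftOrder pos cut) :
    G.tableau.IsStandard (rowDensity k) := by
  have hrange : ∀ {i j a}, a ∈ G.tableau i j → 1 ≤ a ∧ a ≤ (k + 1) * n := fun ha =>
    h.mem_Icc_of_mem_rowLabels (mem_blockOf.1 ha).1
  constructor
  case mem_range =>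
    intro i j a ha
    rw [sum_rowDensity hk]
    exact hrange ha
  case existsUnique_cell =>
    intro a ha haN
    rw [sum_rowDensity hk] at haN
    obtain ⟨i, hi, huniq⟩ := h.existsUnique_rowLabels ha haN
    have hlt : rankIn (G.rowLabels i) a / rowDensity k i < n := by
      refine Nat.div_lt_of_lt_mul ?_
      rw [mul_comm, ← h.card_rowLabels hk]
      exact rankIn_lt_card hi
    refine ⟨(i, ⟨_, hlt⟩), mem_blockOf.2 ⟨hi, rfl⟩, ?_⟩
    rintro ⟨i', j⟩ hc
    obtain ⟨h1, h2⟩ := mem_blockOf.1 hc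
    obtain rfl := huniq i' h1
    exact Prod.ext rfl (Fin.ext h2.symm)
  case card_cell =>
    exact fun i j => card_blockOf (rowDensity_pos hk i) (h.card_rowLabels hk i) j.isLt
  case row_lt =>
    intro i j j' hj a ha b hb
    obtain ⟨-, ha⟩ := mem_blockOf.1 ha
    obtain ⟨-, hb⟩ := mem_blockOf.1 hb
    by_contra hlt
    have := Nat.div_le_div_right (c := rowDensity k i)
      (rankIn_mono (G.rowLabels i) (not_lt.1 hlt))
    omega
  case col_lt =>
    intro i i' j hi a ha b hb
    fin_cases i <;> fin_cases i' <;> simp at hi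
    · exact h.tableau_zero_lt_one hk j ha hb
    -- The tableau is the reflection of that of the rotated graph, where these two rows are the
    -- middle and the top one.
    · have hT := h.rotate.tableau_rotate hk
      rw [PGraph.rotate_rotate] at hT
      rw [hT] at ha hb
      obtain ⟨a', ha', rfl⟩ := Finset.mem_image.1 ha
      obtain ⟨b', hb', rfl⟩ := Finset.mem_image.1 hb
      have h1 := h.rotate.tableau_zero_lt_one hk _ hb' ha'
      have h2 := h.rotate.mem_Icc_of_mem_rowLabels (mem_blockOf.1 ha').1
      rw [sum_rowDensity hk]
      omega

end PGraph.IsDepthLeftOrder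

theorem mainTheorem2 (k n : ℕ) (hk : 2 ≤ k) (hn : 1 ≤ n) :
    (∀ G : PC k n, G.tableau ∈ SVT n (rowDensity k)) ∧
    Set.MapsTo (schutzenberger (rowDensity k)) (SVT n (rowDensity k)) (SVT n (rowDensity k)) ∧
    (PC.tableau ∘ PC.rotate : PC k n → SetFilling 3 n) =
      schutzenberger (rowDensity k) ∘ PC.tableau := by
  refine ⟨?_, fun T hT => hT.schutzenberger (rowDensity_rev k), funext ?_⟩
  · rintro ⟨G, hG⟩
    obtain ⟨pos, cut, h⟩ := hG.exists_isDepthLeftOrder (by omega)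
    exact h.isStandard_tableau hk
  · rintro ⟨G, hG⟩
    obtain ⟨pos, cut, h⟩ := hG.exists_isDepthLeftOrder (by omega)
    exact h.tableau_rotate hk
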